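/- Consider autonomous initial value problems $y'=f(y)$, $y(0)=y_0\in\mathbb{R}^N$, with $f:\mathbb{R}^N\to\mathbb{R}^N$ of class $C^\infty$ and $N$ arbitrary. Let $s\ge 1$ and let real coefficients $a_{i,j}$ ($1\le j\le i\le s-1$), $b_j$ ($1\le j\le s$), $g_{i,j}$ ($1\le j\le i\le s$), $p_{j,k}$ ($1\le k\le j\le s$) be given. Put $\varphi_k(z)=\sum_{i\ge 0} z^i/(i+k)!$ and $\psi_j(z)=\sum_{k=1}^{j}p_{j,k}\,\varphi_k(z)$. For a matrix $\mathbf{A}\in\mathbb{R}^{N\times N}$ and a step size $h>0$, one step of the scheme from $y_0$ is $$Y_0=y_0,\qquad Y_i=y_0+a_{i,1}\,\psi_1(g_{i,1}h\mathbf{A})\,hf(y_0)+\sum_{j=2}^{i}a_{i,j}\,\psi_j(g_{i,j}h\mathbf{A})\,h\,\Delta^{(j-1)}r(Y_0),\quad i=1,\dots,s-1,$$ $$y_1=y_0+b_1\,\psi_1(g_{s,1}h\mathbf{A})\,hf(y_0)+\sum_{j=2}^{s}b_j\,\psi_j(g_{s,j}h\mathbf{A})\,h\,\Delta^{(j-1)}r(Y_0),$$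 where $r(y)=f(y)-f(y_0)-\mathbf{A}(y-y_0)$, $\Delta^{(0)}r(Y_i)=r(Y_i)$ and $\Delta^{(j)}r(Y_i)=\Delta^{(j-1)}r(Y_{i+1})-\Delta^{(j-1)}r(Y_i)$. Let $\mathbf{J}=f'(y_0)$. The *classical EPIRK method* with these coefficients takes $\mathbf{A}=\mathbf{J}$. The *EPIRK-$K$ method* with Krylov dimension $M$ takes $\mathbf{A}=\mathbf{V}\mathbf{V}^T\mathbf{J}\mathbf{V}\mathbf{V}^T$, where the columns of $\mathbf{V}$ form an orthonormal basis of $\mathrm{span}\{f(y_0),\mathbf{J}f(y_0),\dots,\mathbf{J}^{M-1}f(y_0)\}$. A method has *order $p$* if for all $N$, all such $f$ and all $y_0$ its local error satisfies $y_1-y(h)=O(h^{p+1})$ as $h\to 0^+$, where $y$ is the exact solution. **Corollary.** Let $p\ge 0$ and $M\ge p$ be integers. If the EPIRK-$K$ method with Krylov dimension $M$ and the given coefficients has order $p$, then the classical EPIRK method with the same coefficients has order $p$. -/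

import Mathlib

open Filter Topology Asymptotics
open scoped ContDiff

noncomputable section

namespace EPIRK

/-- The coefficients of an `s`-stage EPIRK scheme. All indices start at `1`; only the entries
`a i j` (`1 ≤ j ≤ i ≤ s - 1`), `b j` (`1 ≤ j ≤ s`), `g i j` (`1 ≤ j ≤ i ≤ s`) and
`p j k` (`1 ≤ k ≤ j ≤ s`) are ever used. -/
structure Coeffs where
  /-- number of stages (the last one produces the new approximation) -/
  s : ℕ
  /-- weights of the internal stages -/
  a : ℕ → ℕ → ℝ
  /-- weights of the final stage -/
  b : ℕ → ℝ
  /-- scalings of the matrix argument -/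
  g : ℕ → ℕ → ℝ
  /-- coefficients of `ψ_j` with respect to the functions `φ_k` -/
  p : ℕ → ℕ → ℝ

/-- `φ_k(A) = ∑_{i ≥ 0} A^i / (i + k)!`. -/
def phi {X : Type*} [NormedAddCommGroup X] [NormedSpace ℝ X] (k : ℕ) (A : X →L[ℝ] X) : X →L[ℝ] X :=
  ∑' i : ℕ, ((Nat.factorial (i + k) : ℝ)⁻¹) • A ^ i

/-- `ψ_j(A) = ∑_{k = 1}^{j} p_{j,k} φ_k(A)`. -/
def psi (c : Coeffs) {X : Type*} [NormedAddCommGroup X] [NormedSpace ℝ X]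
    (j : ℕ) (A : X →L[ℝ] X) : X →L[ℝ] X :=
  ∑ k ∈ Finset.Icc 1 j, c.p j k • phi k A

/-- The nonlinear remainder `r(y) = f(y) - f(y₀) - A (y - y₀)`. -/
def remainder {X : Type*} [NormedAddCommGroup X] [NormedSpace ℝ X]
    (f : X → X) (A : X →L[ℝ] X) (y₀ y : X) : X :=
  f y - f y₀ - A (y - y₀)

/-- Forward differences along a sequence of stages:
`Δ^(0) r(Y_i) = r(Y_i)` and `Δ^(j+1) r(Y_i) = Δ^(j) r(Y_{i+1}) - Δ^(j) r(Y_i)`. -/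
def forwardDiff {X : Type*} [NormedAddCommGroup X] [NormedSpace ℝ X]
    (r : X → X) (Y : ℕ → X) : ℕ → ℕ → X
  | 0, i => r (Y i)
  | j + 1, i => forwardDiff r Y j (i + 1) - forwardDiff r Y j i

/-- Row `i` of the scheme with weights `w`, evaluated on the stages `Y` (with `Y 0 = y₀`):
`y₀ + w_1 ψ_1(g_{i,1} h A) h f(y₀) + ∑_{j = 2}^{i} w_j ψ_j(g_{i,j} h A) h Δ^(j-1) r(y₀)`.
It depends on the stages `Y 0, …, Y (i - 1)` only. -/
def row (c : Coeffs) {X : Type*} [NormedAddCommGroup X] [NormedSpace ℝ X]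
    (f : X → X) (A : X →L[ℝ] X) (y₀ : X) (h : ℝ)
    (i : ℕ) (w : ℕ → ℝ) (Y : ℕ → X) : X :=
  y₀ + w 1 • psi c 1 ((c.g i 1 * h) • A) (h • f y₀)
    + ∑ j ∈ Finset.Icc 2 i,
        w j • psi c j ((c.g i j * h) • A)
          (h • forwardDiff (remainder f A y₀) Y (j - 1) 0)

/-- `stages c f A y₀ h n` is a sequence whose entries `0, …, n` are the stage vectors
`Y_0 = y₀, Y_1, …, Y_n`; they are computed one after the other. -/
def stages (c : Coeffs) {X : Type*} [NormedAddCommGroup X] [NormedSpace ℝ X]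
    (f : X → X) (A : X →L[ℝ] X) (y₀ : X) (h : ℝ) :
    ℕ → ℕ → X
  | 0 => fun _ => y₀
  | n + 1 => Function.update (stages c f A y₀ h n) (n + 1)
      (row c f A y₀ h (n + 1) (c.a (n + 1)) (stages c f A y₀ h n))

/-- One step of size `h` from `y₀`, with the matrix `A` in the place of the Jacobian
(the `W`-formulation, with the remainder formed with the same `A`). -/
def step (c : Coeffs) {X : Type*} [NormedAddCommGroup X] [NormedSpace ℝ X]
    (f : X → X) (A : X →L[ℝ] X) (y₀ : X) (h : ℝ) : X :=
  row c f A y₀ h c.s c.b (stages c f A y₀ h (c.s - 1))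

/-- The Krylov space `span {f₀, J f₀, …, J^(M-1) f₀}`, with `f₀ = f(y₀)`, `J = f'(y₀)`. -/
def krylovSpace (M : ℕ) {X : Type*} [NormedAddCommGroup X] [InnerProductSpace ℝ X]
    (f : X → X) (y₀ : X) : Submodule ℝ X :=
  Submodule.span ℝ ((fun i : ℕ => ((fderiv ℝ f y₀) ^ i) (f y₀)) '' {i | i < M})

/-- The Krylov approximation `A = V Vᵀ J V Vᵀ` of the Jacobian `J = f'(y₀)`. The columns of `V`
are an orthonormal basis of the Krylov space, so `V Vᵀ` is the orthogonal projection onto it. -/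
def krylovJacobian (M : ℕ) {X : Type*} [NormedAddCommGroup X] [InnerProductSpace ℝ X]
    [FiniteDimensional ℝ X] (f : X → X) (y₀ : X) : X →L[ℝ] X :=
  (krylovSpace M f y₀).starProjection ∘L fderiv ℝ f y₀ ∘L (krylovSpace M f y₀).starProjection

/-- The state space `ℝ^N` with the Euclidean inner product. -/
abbrev E (N : ℕ) : Type := EuclideanSpace ℝ (Fin N)

/-- A one-step method for autonomous systems `y' = f(y)` of every dimension `N`: it maps the
right-hand side, the current value and the step size to the next value. -/
abbrev OneStepMethod : Type := (N : ℕ) → (E N → E N) → E N → ℝ → E N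

/-- The classical EPIRK method: the matrix is the exact Jacobian `f'(y₀)`. -/
def classicalMethod (c : Coeffs) : OneStepMethod :=
  fun _ f y₀ h => step c f (fderiv ℝ f y₀) y₀ h

/-- The EPIRK-`K` method with Krylov dimension `M`. -/
def kMethod (c : Coeffs) (M : ℕ) : OneStepMethod :=
  fun _ f y₀ h => step c f (krylovJacobian M f y₀) y₀ h

/-- The method has (classical, nonstiff) order (at least) `p`: for every smooth system and every
initial value, the local error of one step of size `h` is `O(h^(p+1))` as `h → 0+`. -/
def HasOrder (Φ : OneStepMethod) (p : ℕ) : Prop :=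
  ∀ (N : ℕ) (f : E N → E N), ContDiff ℝ ∞ f → ∀ (y₀ : E N) (y : ℝ → E N), y 0 = y₀ →
    (∀ᶠ t in 𝓝 (0 : ℝ), HasDerivAt y (f (y t)) t) →
    (fun h : ℝ => Φ N f y₀ h - y h) =O[𝓝[>] (0 : ℝ)] fun h : ℝ => h ^ (p + 1)

end EPIRK

end

/-! A step of size `h` for `f` is a step of size `1` for `h • f` (`step_smul`). So in a family of
vector fields linear in `θ`, the local error of the classical method is a smooth function of `h • θ`
up to `O(h ^ (p + 1))`. Its Taylor coefficients at `0` are forms in `θ` of degree `q ≤ p`, and the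
order conditions say that they vanish (`exists_orderConditions`).

In dimension `d ≤ M` the two methods agree whenever `f(y₀), J f(y₀), …, J^(d-1) f(y₀)` span the
space, since the projection is then the identity. Such data are dense, and the order conditions are
continuous, so the classical method has order `p` for every system of dimension at most `M`
(`localOrder_of_le`).

For arbitrary `N`, weight the components of `f` by `θ : Fin N → ℝ`. If `θ` is the indicator of a set
`S` with at most `M` elements, the system preserves a coordinate plane of dimension `S.card` through
`y₀`, so the conditions hold there. A form of degree `q ≤ p ≤ M` vanishing at all indicators of at
most `q` coordinates also vanishes at `θ = (1, …, 1)`, which is `f` itself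
(`map_sum_eq_zero_of_card_le`). -/

noncomputable section

namespace EPIRK

/-! ### Taylor expansion and comparison of coefficients. -/

section Taylor

variable {X : Type*} [NormedAddCommGroup X] [NormedSpace ℝ X]

/-- A function that vanishes at `0` and whose derivative is `O(t ^ n)` is `O(t ^ (n + 1))`. -/
theorem isBigO_pow_succ_of_hasDerivAt {e e' : ℝ → X} {n : ℕ} (h0 : e 0 = 0)
    (he : ∀ᶠ t in 𝓝 (0 : ℝ), HasDerivAt e (e' t) t)
    (hO : e' =O[𝓝 0] fun t : ℝ => t ^ n) : e =O[𝓝 0] fun t : ℝ => t ^ (n + 1) := by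
  obtain ⟨C, hC⟩ := hO.bound
  obtain ⟨r, hr, hball⟩ := Metric.eventually_nhds_iff_ball.1 (he.and hC)
  refine IsBigO.of_bound C ?_
  filter_upwards [Metric.ball_mem_nhds (0 : ℝ) hr] with t ht
  have hmem : ∀ x ∈ Metric.closedBall (0 : ℝ) |t|, x ∈ Metric.ball (0 : ℝ) r := fun x hx => by
    simp only [Metric.mem_closedBall, Metric.mem_ball, dist_zero_right, Real.norm_eq_abs] at *
    exact hx.trans_lt ht
  have hC0 : 0 ≤ C * |t| ^ n := (norm_nonneg (e' t)).trans (by simpa using (hball t ht).2)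
  have hCn : ∀ x ∈ Metric.closedBall (0 : ℝ) |t|, ‖e' x‖ ≤ C * |t| ^ n := fun x hx => by
    have hb := (hball x (hmem x hx)).2
    have hxt : |x| ≤ |t| := by simpa using hx
    rw [norm_pow, Real.norm_eq_abs] at hb
    -- The constant `C` may be negative; then `0 ≤ C * |t| ^ n` forces both powers to be zero.
    rcases le_or_gt 0 C with h | h
    · exact hb.trans (by gcongr)
    · have ht0 : |t| ^ n = 0 := by
        have := pow_nonneg (abs_nonneg t) n
        nlinarith
      have hx0 : |x| ^ n = 0 := le_antisymm (ht0 ▸ by gcongr) (by positivity)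
      rw [ht0]; rwa [hx0] at hb
  have := (convex_closedBall (0 : ℝ) |t|).norm_image_sub_le_of_norm_hasDerivWithin_le
    (fun x hx => (hball x (hmem x hx)).1.hasDerivWithinAt) hCn
    (Metric.mem_closedBall_self (abs_nonneg t)) (show t ∈ Metric.closedBall (0 : ℝ) |t| by simp)
  simpa [h0, pow_succ, mul_assoc] using this

/-- Taylor expansion at `0` along a chain of successive derivatives. -/
theorem taylor_isBigO_of_hasDerivAt (v : ℕ → ℝ → X)
    (hv : ∀ q, ∀ᶠ t in 𝓝 (0 : ℝ), HasDerivAt (v q) (v (q + 1) t) t) (n : ℕ) :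
    (fun h => v 0 h - ∑ q ∈ Finset.range n, (h ^ q / (q.factorial : ℝ)) • v q 0)
      =O[𝓝 0] fun h : ℝ => h ^ n := by
  induction n generalizing v with
  | zero =>
    simpa using (hv 0).self_of_nhds.continuousAt.isBigO_one ℝ
  | succ n ih =>
    refine isBigO_pow_succ_of_hasDerivAt ?_ ?_ (ih (fun q => v (q + 1)) fun q => hv (q + 1))
    · rw [Finset.sum_range_succ']
      simp
    · filter_upwards [hv 0] with t ht
      refine ht.sub ?_
      simp_rw [Finset.sum_range_succ' _ n]
      rw [← add_zero (∑ q ∈ Finset.range n, _)]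
      refine (HasDerivAt.fun_sum fun q _ => ?_).add ?_
      · have h1 : HasDerivAt (fun t : ℝ => t ^ (q + 1) / ((q + 1).factorial : ℝ))
            (t ^ q / (q.factorial : ℝ)) t := by
          convert! (hasDerivAt_pow (q + 1) t).div_const ((q + 1).factorial : ℝ) using 1
          rw [Nat.factorial_succ]
          push_cast
          have : (q.factorial : ℝ) ≠ 0 := by positivity
          field_simp
        exact h1.smul_const _
      · simpa using hasDerivAt_const t (v 0 0)

/-- A polynomial of degree less than `n` that is `O(h ^ n)` as `h → 0+` vanishes. -/
theorem eq_zero_of_sum_isBigO_pow {n : ℕ} {c : ℕ → X}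
    (h : (fun h : ℝ => ∑ q ∈ Finset.range n, h ^ q • c q) =O[𝓝[>] (0 : ℝ)] fun h : ℝ => h ^ n) :
    ∀ q < n, c q = 0 := by
  induction n generalizing c with
  | zero => simp
  | succ n ih =>
    have h0 : c 0 = 0 := by
      have hlim : Tendsto (fun h : ℝ => ∑ q ∈ Finset.range (n + 1), h ^ q • c q) (𝓝[>] (0 : ℝ))
          (𝓝 (c 0)) := by
        have hc : Continuous (fun h : ℝ => ∑ q ∈ Finset.range (n + 1), h ^ q • c q) := by
          fun_prop
        have := (hc.tendsto 0).mono_left (nhdsWithin_le_nhds (s := Set.Ioi 0))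
        simpa [Finset.sum_range_succ'] using this
      have hz : Tendsto (fun h : ℝ => h ^ (n + 1)) (𝓝[>] (0 : ℝ)) (𝓝 0) := by
        have := ((continuous_pow (n + 1)).tendsto (0 : ℝ)).mono_left
          (nhdsWithin_le_nhds (s := Set.Ioi 0))
        simpa using this
      exact tendsto_nhds_unique hlim (h.trans_tendsto hz)
    have hs : (fun h : ℝ => ∑ q ∈ Finset.range n, h ^ q • c (q + 1))
        =O[𝓝[>] (0 : ℝ)] fun h : ℝ => h ^ n := by
      obtain ⟨C, hC⟩ := h.bound
      refine IsBigO.of_bound C ?_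
      filter_upwards [hC, self_mem_nhdsWithin] with t ht htpos
      have htpos : 0 < t := htpos
      have : ∑ q ∈ Finset.range (n + 1), t ^ q • c q
          = t • ∑ q ∈ Finset.range n, t ^ q • c (q + 1) := by
        rw [Finset.sum_range_succ', h0, Finset.smul_sum]
        simp [smul_smul, pow_succ']
      rw [this, norm_smul, pow_succ', norm_mul, mul_left_comm] at ht
      exact le_of_mul_le_mul_left ht (norm_pos_iff.2 htpos.ne')
    intro q hq
    cases q with
    | zero => exact h0
    | succ q => exact ih hs q (by omega)

/-- Turns an order estimate into equations on coefficients, given an expansion of `e`. -/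
theorem sum_isBigO_pow_iff {n : ℕ} {c : ℕ → X} {e : ℝ → X}
    (he : (fun h => e h - ∑ q ∈ Finset.range n, h ^ q • c q) =O[𝓝[>] 0] fun h : ℝ => h ^ n) :
    e =O[𝓝[>] 0] (fun h : ℝ => h ^ n) ↔ ∀ q < n, c q = 0 := by
  constructor
  · intro h
    refine eq_zero_of_sum_isBigO_pow ?_
    simpa using h.sub he
  · intro h
    refine he.congr_left fun t => ?_
    rw [Finset.sum_eq_zero fun q hq => by rw [h q (Finset.mem_range.1 hq), smul_zero], sub_zero]

end Taylor

/-! ### Smoothness of the `φ` and `ψ` functions of an operator. -/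

section Phi

variable {X : Type*} [NormedAddCommGroup X] [NormedSpace ℝ X]

theorem summable_phi [CompleteSpace X] (k : ℕ) (A : X →L[ℝ] X) :
    Summable fun i : ℕ => ((Nat.factorial (i + k) : ℝ)⁻¹) • A ^ i := by
  refine Summable.of_norm_bounded_eventually_nat (Real.summable_pow_div_factorial ‖A‖) ?_
  filter_upwards [eventually_gt_atTop 0] with i hi
  rw [norm_smul, norm_inv, Real.norm_natCast, div_eq_inv_mul]
  gcongr
  · omega
  · exact norm_pow_le' A hi

/-- The coefficients `1 / (i + k)!` have ratios tending to `0`, so the power series has infinite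
radius and its sum is analytic on the whole operator algebra. -/
theorem contDiff_phi [CompleteSpace X] (k : ℕ) :
    ContDiff ℝ ∞ (phi k : (X →L[ℝ] X) → X →L[ℝ] X) := by
  set c : ℕ → ℝ := fun i => ((Nat.factorial (i + k) : ℝ)⁻¹) with hc
  have hrad : (FormalMultilinearSeries.ofScalars (X →L[ℝ] X) c).radius = ⊤ := by
    refine FormalMultilinearSeries.ofScalars_radius_eq_top_of_tendsto _ _
      (Eventually.of_forall fun n => by positivity) ?_
    have : ∀ n : ℕ, ‖c n.succ‖ / ‖c n‖ = 1 / ((n + k : ℕ) + 1 : ℝ) := fun n => by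
      simp only [hc, norm_inv, Real.norm_natCast]
      rw [show n.succ + k = (n + k) + 1 by omega, Nat.factorial_succ]
      have : ((n + k).factorial : ℝ) ≠ 0 := by positivity
      push_cast
      field_simp
    simp_rw [this]
    exact (tendsto_add_atTop_iff_nat k).2 tendsto_one_div_add_atTop_nhds_zero_nat
  have hph : (phi k : (X →L[ℝ] X) → X →L[ℝ] X) =
      (FormalMultilinearSeries.ofScalars (X →L[ℝ] X) c).sum := by
    funext A
    simp [phi, FormalMultilinearSeries.sum, FormalMultilinearSeries.ofScalars_apply_eq, c]
  have hA := (FormalMultilinearSeries.ofScalars (X →L[ℝ] X) c).hasFPowerSeriesOnBall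
    (by rw [hrad]; exact ENNReal.zero_lt_top)
  rw [hrad, ← hph] at hA
  refine contDiff_iff_contDiffAt.2 fun A => ?_
  exact (hA.analyticAt_of_mem (by simp)).contDiffAt

theorem contDiff_psi [CompleteSpace X] (c : Coeffs) (j : ℕ) :
    ContDiff ℝ ∞ (psi c j : (X →L[ℝ] X) → X →L[ℝ] X) := by
  unfold psi
  exact ContDiff.sum fun k _ => (contDiff_phi k).const_smul _

end Phi

/-! ### Absorbing the step size into the vector field. -/

section Scaling

variable {X : Type*} [NormedAddCommGroup X] [NormedSpace ℝ X]

theorem forwardDiff_smul (r : X → X) (Y : ℕ → X) (h : ℝ) (j i : ℕ) :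
    forwardDiff (h • r) Y j i = h • forwardDiff r Y j i := by
  induction j generalizing i with
  | zero => rfl
  | succ j ih => simp only [forwardDiff, ih, smul_sub]

theorem remainder_smul (f : X → X) (A : X →L[ℝ] X) (y₀ : X) (h : ℝ) :
    remainder (h • f) (h • A) y₀ = h • remainder f A y₀ := by
  funext y
  simp [remainder, smul_sub]

theorem row_smul (c : Coeffs) (f : X → X) (A : X →L[ℝ] X) (y₀ : X) (h : ℝ) (i : ℕ) (w : ℕ → ℝ)
    (Y : ℕ → X) : row c (h • f) (h • A) y₀ 1 i w Y = row c f A y₀ h i w Y := by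
  simp only [row, remainder_smul, forwardDiff_smul, mul_one, one_mul, smul_smul, Pi.smul_apply]

theorem stages_smul (c : Coeffs) (f : X → X) (A : X →L[ℝ] X) (y₀ : X) (h : ℝ) (n : ℕ) :
    stages c (h • f) (h • A) y₀ 1 n = stages c f A y₀ h n := by
  induction n with
  | zero => rfl
  | succ n ih => simp only [stages, ih, row_smul]

/-- A step of size `h` is a step of size `1` for the right-hand side `h f`. -/
theorem step_smul (c : Coeffs) (f : X → X) (A : X →L[ℝ] X) (y₀ : X) (h : ℝ) :
    step c (h • f) (h • A) y₀ 1 = step c f A y₀ h := by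
  simp only [step, stages_smul, row_smul]

end Scaling

/-! ### Equivariance of the scheme under affine maps. -/

section Equivariance

variable {X Z : Type*} [NormedAddCommGroup X] [NormedSpace ℝ X]
  [NormedAddCommGroup Z] [NormedSpace ℝ Z]
  {ι : X →L[ℝ] Z} {A : X →L[ℝ] X} {B : Z →L[ℝ] Z}

theorem forwardDiff_intertwine {r : X → X} {R : Z → Z} {Y : ℕ → X} {W : ℕ → Z}
    (h : ∀ i, R (W i) = ι (r (Y i))) (j i : ℕ) :
    forwardDiff R W j i = ι (forwardDiff r Y j i) := by
  induction j generalizing i with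
  | zero => exact h i
  | succ j ih => simp only [forwardDiff, ih, map_sub]

variable [CompleteSpace X] [CompleteSpace Z]

/-- The relation `B ι = ι A` passes to powers, and then to the convergent series termwise. -/
theorem psi_intertwine (c : Coeffs) (j : ℕ) (hAB : ∀ x, B (ι x) = ι (A x)) (x : X) :
    psi c j B (ι x) = ι (psi c j A x) := by
  have hpow : ∀ (i : ℕ) (x : X), (B ^ i) (ι x) = ι ((A ^ i) x) := fun i => by
    induction i with
    | zero => simp
    | succ i ih => intro x; simp [pow_succ, hAB, ih]
  have hphi : ∀ k, phi k B (ι x) = ι (phi k A x) := fun k => by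
    have hB := (ContinuousLinearMap.apply ℝ Z (ι x)).hasSum (summable_phi k B).hasSum
    have hA := (ι ∘L ContinuousLinearMap.apply ℝ X x).hasSum (summable_phi k A).hasSum
    refine hB.unique ?_
    convert! hA using 1
    funext i
    simp [hpow]
  simp [psi, hphi]

variable {F : Z → Z} {g : X → X} {z₀ : Z}

theorem row_intertwine (c : Coeffs) (hAB : ∀ x, B (ι x) = ι (A x))
    (hF : ∀ x, F (z₀ + ι x) = ι (g x)) (h : ℝ) (i : ℕ) (w : ℕ → ℝ) (Y : ℕ → X) :
    row c F B z₀ h i w (fun n => z₀ + ι (Y n)) = z₀ + ι (row c g A 0 h i w Y) := by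
  have hF0 : F z₀ = ι (g 0) := by simpa using hF 0
  have hr : ∀ n, remainder F B z₀ (z₀ + ι (Y n)) = ι (remainder g A 0 (Y n)) := fun n => by
    simp [remainder, hF, hF0, hAB]
  have hpsi : ∀ (j : ℕ) (t : ℝ) (x : X), psi c j (t • B) (ι x) = ι (psi c j (t • A) x) :=
    fun j t x => psi_intertwine c j (by simp [hAB]) x
  simp only [row, hF0, forwardDiff_intertwine hr, ← map_smul, hpsi, ← map_sum, map_add, zero_add,
    add_assoc]

theorem stages_intertwine (c : Coeffs) (hAB : ∀ x, B (ι x) = ι (A x))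
    (hF : ∀ x, F (z₀ + ι x) = ι (g x)) (h : ℝ) (n : ℕ) :
    stages c F B z₀ h n = fun i => z₀ + ι (stages c g A 0 h n i) := by
  induction n with
  | zero => funext i; simp [stages]
  | succ n ih =>
    funext i
    simp only [stages, ih, row_intertwine c hAB hF]
    by_cases hi : i = n + 1
    · subst hi; simp
    · simp [Function.update_of_ne hi]

/-- The scheme commutes with affine maps that conjugate the vector fields and the matrices. -/
theorem step_intertwine (c : Coeffs) (hAB : ∀ x, B (ι x) = ι (A x))
    (hF : ∀ x, F (z₀ + ι x) = ι (g x)) (h : ℝ) :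
    step c F B z₀ h = z₀ + ι (step c g A 0 h) := by
  simp only [step, stages_intertwine c hAB hF, row_intertwine c hAB hF]

end Equivariance

/-! ### Smooth dependence of one step on parameters. -/

section Smoothness

variable {Θ X : Type*} [NormedAddCommGroup Θ] [NormedSpace ℝ Θ]
  [NormedAddCommGroup X] [NormedSpace ℝ X]
  {f : Θ → X → X} {A : Θ → X →L[ℝ] X}

theorem contDiff_forwardDiff_remainder (hf : ContDiff ℝ ∞ (Function.uncurry f))
    (hA : ContDiff ℝ ∞ A) (y₀ : X) {Y : Θ → ℕ → X} (hY : ∀ i, ContDiff ℝ ∞ fun θ => Y θ i)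
    (j i : ℕ) :
    ContDiff ℝ ∞ fun θ => forwardDiff (remainder (f θ) (A θ) y₀) (Y θ) j i := by
  induction j generalizing i with
  | zero =>
    have h1 : ContDiff ℝ ∞ fun θ => f θ (Y θ i) := hf.comp (contDiff_id.prodMk (hY i))
    have h2 : ContDiff ℝ ∞ fun θ => f θ y₀ := hf.comp (contDiff_id.prodMk contDiff_const)
    exact (h1.sub h2).sub (hA.clm_apply ((hY i).sub contDiff_const))
  | succ j ih => exact (ih (i + 1)).sub (ih i)

variable [CompleteSpace X]

theorem contDiff_row (c : Coeffs) (hf : ContDiff ℝ ∞ (Function.uncurry f))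
    (hA : ContDiff ℝ ∞ A) (y₀ : X) (h : ℝ) (i : ℕ) (w : ℕ → ℝ) {Y : Θ → ℕ → X}
    (hY : ∀ i, ContDiff ℝ ∞ fun θ => Y θ i) :
    ContDiff ℝ ∞ fun θ => row c (f θ) (A θ) y₀ h i w (Y θ) := by
  have hpsi : ∀ (j : ℕ) (t : ℝ), ContDiff ℝ ∞ fun θ => psi c j (t • A θ) := fun j t =>
    (contDiff_psi c j).comp (hA.const_smul t)
  have h2 : ContDiff ℝ ∞ fun θ => f θ y₀ := hf.comp (contDiff_id.prodMk contDiff_const)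
  refine (contDiff_const.add (((hpsi _ _).clm_apply (h2.const_smul h)).const_smul _)).add ?_
  refine ContDiff.sum fun j _ => ContDiff.const_smul _ ((hpsi _ _).clm_apply ?_)
  exact (contDiff_forwardDiff_remainder hf hA y₀ hY _ _).const_smul h

theorem contDiff_stages (c : Coeffs) (hf : ContDiff ℝ ∞ (Function.uncurry f))
    (hA : ContDiff ℝ ∞ A) (y₀ : X) (h : ℝ) (n i : ℕ) :
    ContDiff ℝ ∞ fun θ => stages c (f θ) (A θ) y₀ h n i := by
  induction n generalizing i with
  | zero => exact contDiff_const
  | succ n ih =>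
    simp only [stages]
    by_cases hi : i = n + 1
    · subst hi
      simpa using contDiff_row c hf hA y₀ h _ _ ih
    · simpa [Function.update_of_ne hi] using ih i

theorem contDiff_step (c : Coeffs) (hf : ContDiff ℝ ∞ (Function.uncurry f))
    (hA : ContDiff ℝ ∞ A) (y₀ : X) (h : ℝ) :
    ContDiff ℝ ∞ fun θ => step c (f θ) (A θ) y₀ h :=
  contDiff_row c hf hA y₀ h _ _ fun i => contDiff_stages c hf hA y₀ h _ i

end Smoothness

/-! ### Taylor coefficients of the exact solution. -/

section LieDerivative

variable {X : Type*} [NormedAddCommGroup X] [NormedSpace ℝ X]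

/-- Iterated Lie derivatives of the identity along `f`: the `q`-th derivative of a solution `y` of
`y' = f(y)` is `lieIter f q ∘ y`. -/
def lieIter (f : X → X) : ℕ → X → X
  | 0 => id
  | q + 1 => fun y => fderiv ℝ (lieIter f q) y (f y)

theorem lieIter_smul (f : X → X) (h : ℝ) (q : ℕ) : lieIter (h • f) q = h ^ q • lieIter f q := by
  induction q with
  | zero => simp [lieIter]
  | succ q ih =>
    funext y
    simp only [lieIter, ih, Pi.smul_apply, map_smul, fderiv_const_smul_field]
    simp [smul_smul, pow_succ']

theorem contDiff_lieIter {Θ : Type*} [NormedAddCommGroup Θ] [NormedSpace ℝ Θ]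
    {f : Θ → X → X} (hf : ContDiff ℝ ∞ (Function.uncurry f)) (q : ℕ) :
    ContDiff ℝ ∞ fun z : Θ × X => lieIter (f z.1) q z.2 := by
  induction q with
  | zero => exact contDiff_snd
  | succ q ih =>
    refine ContDiff.clm_apply ?_ hf
    refine ContDiff.fderiv (m := ∞) (n := ∞) (f := fun (z : Θ × X) (y : X) => lieIter (f z.1) q y)
      ?_ contDiff_snd (by simp)
    exact ih.comp ((contDiff_fst.comp contDiff_fst).prodMk contDiff_snd)

theorem solution_taylor {f : X → X} (hf : ContDiff ℝ ∞ f) {y : ℝ → X}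
    (hy : ∀ᶠ t in 𝓝 (0 : ℝ), HasDerivAt y (f (y t)) t) (n : ℕ) :
    (fun h => y h - ∑ q ∈ Finset.range n, (h ^ q / (q.factorial : ℝ)) • lieIter f q (y 0))
      =O[𝓝 0] fun h : ℝ => h ^ n := by
  refine taylor_isBigO_of_hasDerivAt (fun q t => lieIter f q (y t)) (fun q => ?_) n
  -- The parametrised smoothness result is used for a constant family with dummy parameter space
  -- `ℝ`.
  have hsm : ContDiff ℝ ∞ (lieIter f q) :=
    (contDiff_lieIter (Θ := ℝ) (f := fun _ => f) (hf.comp contDiff_snd) q).comp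
      (contDiff_const (c := (0 : ℝ)).prodMk contDiff_id)
  filter_upwards [hy] with t ht
  exact ((hsm.differentiable (by simp)) (y t)).hasFDerivAt.comp_hasDerivAt t ht

theorem exists_solution [CompleteSpace X] {f : X → X} (hf : ContDiff ℝ ∞ f) (y₀ : X) :
    ∃ y : ℝ → X, y 0 = y₀ ∧ ∀ᶠ t in 𝓝 (0 : ℝ), HasDerivAt y (f (y t)) t := by
  obtain ⟨y, hy0, ε, hε, hy⟩ :=
    ((hf.contDiffAt (x := y₀)).of_le (by simp)
      : ContDiffAt ℝ 1 f y₀).exists_forall_mem_closedBall_exists_eq_forall_mem_Ioo_hasDerivAt₀ 0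
  refine ⟨y, hy0, ?_⟩
  filter_upwards [Ioo_mem_nhds (by linarith : 0 - ε < 0) (by linarith : 0 < 0 + ε)] with t ht
  exact hy t ht

end LieDerivative

/-! ### Order conditions as homogeneous polynomial equations. -/

section Family

variable {Θ X : Type*} [NormedAddCommGroup Θ] [NormedSpace ℝ Θ]
  [NormedAddCommGroup X] [NormedSpace ℝ X]

theorem line_taylor {G : Θ → X} (hG : ContDiff ℝ ∞ G) (θ : Θ) (n : ℕ) :
    (fun h : ℝ => G (h • θ) - ∑ q ∈ Finset.range n,
      (h ^ q / (q.factorial : ℝ)) • iteratedFDeriv ℝ q G 0 fun _ => θ)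
      =O[𝓝 0] fun h : ℝ => h ^ n := by
  set L : ℝ →L[ℝ] Θ := ContinuousLinearMap.toSpanSingleton ℝ θ with hL
  have hGL : ContDiff ℝ ∞ (G ∘ L) := hG.comp L.contDiff
  have h1 := taylor_isBigO_of_hasDerivAt (fun q => iteratedDeriv q (G ∘ L))
    (fun q => Eventually.of_forall fun t => by
      rw [iteratedDeriv_succ]
      exact (hGL.differentiable_iteratedDeriv q (by exact_mod_cast ENat.natCast_lt_top q)
        t).hasDerivAt) n
  refine h1.congr_left fun t => ?_
  simp only [iteratedDeriv_eq_iteratedFDeriv]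
  congr 1
  refine Finset.sum_congr rfl fun q _ => ?_
  rw [L.iteratedFDeriv_comp_right hG 0 (by exact_mod_cast le_top)]
  simp [hL]

/-- The local error of the classical method is `O(h ^ (p + 1))`. -/
def LocalOrder (c : Coeffs) (p : ℕ) (f : X → X) (y₀ : X) : Prop :=
  ∀ y : ℝ → X, y 0 = y₀ → (∀ᶠ t in 𝓝 (0 : ℝ), HasDerivAt y (f (y t)) t) →
    (fun h : ℝ => step c f (fderiv ℝ f y₀) y₀ h - y h) =O[𝓝[>] (0 : ℝ)] fun h : ℝ => h ^ (p + 1)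

variable [CompleteSpace X]

/-- In a family of vector fields that is linear in the parameter, the order conditions are
homogeneous polynomial equations in the parameter. -/
theorem exists_orderConditions (c : Coeffs) (p : ℕ) {f : Θ → X → X}
    (hf : ContDiff ℝ ∞ (Function.uncurry f)) (hhom : ∀ (h : ℝ) θ, f (h • θ) = h • f θ) (y₀ : X) :
    ∃ m : (q : ℕ) → ContinuousMultilinearMap ℝ (fun _ : Fin q => Θ) X,
      ∀ θ, LocalOrder c p (f θ) y₀ ↔ ∀ q ≤ p, m q (fun _ => θ) = 0 := by
  have hJ : ContDiff ℝ ∞ fun θ => fderiv ℝ (f θ) y₀ :=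
    ContDiff.fderiv (n := ∞) hf contDiff_const (by simp)
  set T : Θ → X := fun θ =>
    ∑ q ∈ Finset.range (p + 1), ((q.factorial : ℝ)⁻¹) • lieIter (f θ) q y₀ with hT
  have hTs : ContDiff ℝ ∞ T := ContDiff.sum fun q _ => ContDiff.const_smul _
    ((contDiff_lieIter hf q).comp (contDiff_id.prodMk contDiff_const))
  set G : Θ → X := fun θ => step c (f θ) (fderiv ℝ (f θ) y₀) y₀ 1 - T θ with hGdef
  have hG : ContDiff ℝ ∞ G := (contDiff_step c hf hJ y₀ 1).sub hTs
  refine ⟨fun q => iteratedFDeriv ℝ q G 0, fun θ => ?_⟩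
  have hfθ : ContDiff ℝ ∞ (f θ) := hf.comp (contDiff_const.prodMk contDiff_id)
  -- By homogeneity, moving along the ray through `θ` is the same as varying the step size: the
  -- Jacobian scales by `h` and the `q`-th Lie derivative by `h ^ q`.
  have hGh : ∀ h : ℝ, G (h • θ) = step c (f θ) (fderiv ℝ (f θ) y₀) y₀ h
      - ∑ q ∈ Finset.range (p + 1), (h ^ q / (q.factorial : ℝ)) • lieIter (f θ) q y₀ := fun h => by
    simp only [hGdef, hT, hhom, fderiv_const_smul_field, lieIter_smul, Pi.smul_apply, step_smul,
      smul_smul, div_eq_inv_mul]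
  have key : ∀ y : ℝ → X, y 0 = y₀ → (∀ᶠ t in 𝓝 (0 : ℝ), HasDerivAt y (f θ (y t)) t) →
      ((fun h : ℝ => step c (f θ) (fderiv ℝ (f θ) y₀) y₀ h - y h)
        =O[𝓝[>] (0 : ℝ)] (fun h : ℝ => h ^ (p + 1)) ↔
        ∀ q ≤ p, iteratedFDeriv ℝ q G 0 (fun _ => θ) = 0) := by
    intro y hy0 hy
    have h1 := line_taylor hG θ (p + 1)
    have h2 := solution_taylor hfθ hy (p + 1)
    rw [hy0] at h2
    have h3 : (fun h : ℝ => (step c (f θ) (fderiv ℝ (f θ) y₀) y₀ h - y h)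
        - ∑ q ∈ Finset.range (p + 1),
          h ^ q • (((q.factorial : ℝ)⁻¹) • iteratedFDeriv ℝ q G 0 fun _ => θ))
        =O[𝓝[>] (0 : ℝ)] fun h : ℝ => h ^ (p + 1) := by
      refine ((h1.sub h2).mono nhdsWithin_le_nhds).congr_left fun h => ?_
      rw [hGh]
      simp only [smul_smul, div_eq_mul_inv]
      abel
    rw [sum_isBigO_pow_iff h3]
    simp [Nat.factorial_ne_zero]
  constructor
  -- `LocalOrder` quantifies over solutions, so an actual solution is needed to extract the
  -- equations.
  · intro h
    obtain ⟨y, hy0, hy⟩ := exists_solution hfθ y₀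
    exact (key y hy0 hy).1 (h y hy0 hy)
  · exact fun h y hy0 hy => (key y hy0 hy).2 h

end Family

/-! ### Reduction to an invariant affine subspace. -/

section Reduction

variable {X Z : Type*} [NormedAddCommGroup X] [NormedSpace ℝ X] [CompleteSpace X]
  [NormedAddCommGroup Z] [NormedSpace ℝ Z] [CompleteSpace Z]

/-- The local error can be tested on an invariant affine subspace. -/
theorem LocalOrder.of_intertwine {c : Coeffs} {p : ℕ} {F : Z → Z} {g : X → X} {ι : X →L[ℝ] Z}
    {z₀ : Z} (hF : ContDiff ℝ ∞ F) (hg : ContDiff ℝ ∞ g) (h : ∀ x, F (z₀ + ι x) = ι (g x))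
    (hord : LocalOrder c p g 0) : LocalOrder c p F z₀ := by
  -- Differentiating the conjugacy `h` at `0` shows that `ι` also intertwines the Jacobians.
  have hAB : ∀ x, fderiv ℝ F z₀ (ι x) = ι (fderiv ℝ g 0 x) := by
    have hι : HasFDerivAt (fun x => z₀ + ι x) ι (0 : X) := ι.hasFDerivAt.const_add z₀
    have h1 : HasFDerivAt F (fderiv ℝ F z₀) (z₀ + ι 0) := by
      rw [map_zero, add_zero]
      exact (hF.differentiable (by simp) z₀).hasFDerivAt
    have h2 := h1.comp (0 : X) hι
    have h3 := ι.hasFDerivAt.comp (0 : X) (hg.differentiable (by simp) 0).hasFDerivAt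
    have h4 : F ∘ (fun x => z₀ + ι x) = ι ∘ g := funext h
    rw [h4] at h2
    exact fun x => DFunLike.congr_fun (h2.unique h3) x
  intro z hz0 hz
  obtain ⟨x, hx0, hx⟩ := exists_solution hg 0
  have hx' : ∀ᶠ t in 𝓝 (0 : ℝ), HasDerivAt (fun t => z₀ + ι (x t)) (F (z₀ + ι (x t))) t := by
    filter_upwards [hx] with t ht
    rw [h]
    exact (ι.hasFDerivAt.comp_hasDerivAt t ht).const_add z₀
  -- Uniqueness of solutions is not needed: two solutions with the same initial value share their
  -- Taylor polynomial.
  have hzx : (fun t => z₀ + ι (x t) - z t) =O[𝓝[>] 0] fun t : ℝ => t ^ (p + 1) := by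
    refine (((solution_taylor hF hx' (p + 1)).sub (solution_taylor hF hz (p + 1))).mono
      nhdsWithin_le_nhds).congr_left fun t => ?_
    simp [hx0, hz0]
  have hO := (ι.isBigO_comp (fun t => step c g (fderiv ℝ g 0) 0 t - x t) (𝓝[>] (0 : ℝ))).trans
    (hord x hx0 hx)
  refine (hO.add hzx).congr_left fun t => ?_
  rw [step_intertwine c hAB h, map_sub]
  abel

end Reduction

/-! ### Genericity of cyclic pairs. -/

section Cyclic

variable {d : ℕ}

/-- The vectors `v, J v, …, J^(d-1) v` span `ℝ^d`. -/
def IsCyclicPair (J : E d →L[ℝ] E d) (v : E d) : Prop :=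
  Submodule.span ℝ (Set.range fun i : Fin d => (J ^ (i : ℕ)) v) = ⊤

/-- The determinant of the matrix with columns `v, J v, …, J^(d-1) v`. -/
def krylovDet (J : E d →L[ℝ] E d) (v : E d) : ℝ :=
  Matrix.det (Matrix.of fun i j : Fin d => ((J ^ (j : ℕ)) v) i)

theorem isCyclicPair_iff {J : E d →L[ℝ] E d} {v : E d} :
    IsCyclicPair J v ↔ krylovDet J v ≠ 0 := by
  set e := (EuclideanSpace.basisFun (Fin d) ℝ).toBasis
  have hdet : e.det (fun i : Fin d => (J ^ (i : ℕ)) v) = krylovDet J v := by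
    rw [Module.Basis.det_apply]
    rfl
  rw [← hdet, ← isUnit_iff_ne_zero, ← Module.Basis.is_basis_iff_det]
  refine ⟨fun h => ⟨linearIndependent_of_top_le_span_of_card_eq_finrank h.ge (by simp), h⟩,
    fun h => h.2⟩

/-- Take the diagonal operator with distinct entries `0, …, d - 1` and the all-ones vector; the
Krylov matrix is then a Vandermonde matrix. -/
theorem exists_isCyclicPair (d : ℕ) : ∃ (C : E d →L[ℝ] E d) (w : E d), IsCyclicPair C w := by
  let C : E d →L[ℝ] E d := LinearMap.toContinuousLinearMap
    { toFun := fun x => WithLp.toLp 2 fun i : Fin d => (i : ℝ) * x i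
      map_add' := fun x y => by ext i; simp [mul_add]
      map_smul' := fun r x => by ext i; simp [mul_left_comm] }
  have hC : ∀ x i, C x i = (i : ℝ) * x i := fun x i => rfl
  let w : E d := WithLp.toLp 2 fun _ => 1
  have hpow : ∀ (n : ℕ) (i : Fin d), ((C ^ n) w) i = (i : ℝ) ^ n := fun n i => by
    induction n with
    | zero => simp [w]
    | succ n ih => rw [pow_succ', mul_apply_eq_comp, hC, ih, pow_succ']
  refine ⟨C, w, isCyclicPair_iff.2 ?_⟩
  have : (Matrix.of fun i j : Fin d => ((C ^ (j : ℕ)) w) i)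
      = Matrix.vandermonde fun i : Fin d => (i : ℝ) := by
    ext i j
    exact hpow j i
  rw [krylovDet, this, Matrix.det_vandermonde_ne_zero_iff]
  exact fun i j h => Fin.ext (Nat.cast_injective (R := ℝ) h)

/-- Every pair is a limit of cyclic pairs on the line towards a given cyclic pair. -/
theorem eventually_isCyclicPair {C : E d →L[ℝ] E d} {w : E d} (hCw : IsCyclicPair C w)
    (J : E d →L[ℝ] E d) (v : E d) :
    ∀ᶠ s in 𝓝[≠] (0 : ℝ), IsCyclicPair (J + s • (C - J)) (v + s • (w - v)) := by
  set D : ℝ → ℝ := fun s => krylovDet (J + s • (C - J)) (v + s • (w - v)) with hD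
  have han : AnalyticOnNhd ℝ D Set.univ := fun s _ => by
    have hJ : AnalyticAt ℝ (fun s : ℝ => J + s • (C - J)) s := by fun_prop
    have hv : AnalyticAt ℝ (fun s : ℝ => v + s • (w - v)) s := by fun_prop
    simp only [hD, krylovDet, Matrix.det_apply']
    refine Finset.analyticAt_fun_sum _ fun σ _ => ?_
    refine analyticAt_const.mul (Finset.analyticAt_fun_prod _ fun i _ => ?_)
    have hB := (ContinuousLinearMap.id ℝ (E d →L[ℝ] E d)).analyticAt_bilinear
      ((J + s • (C - J)) ^ (i : ℕ), v + s • (w - v))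
    have hJv : AnalyticAt ℝ
        (fun s : ℝ => ((J + s • (C - J)) ^ (i : ℕ)) (v + s • (w - v))) s :=
      hB.comp₂ (hJ.pow _) hv
    exact ((EuclideanSpace.proj (𝕜 := ℝ) (σ i)).analyticAt _).comp hJv
  -- Zeros of the analytic function `D` are isolated unless `D` vanishes identically, which is
  -- excluded at `s = 1`, where the pair is `(C, w)`.
  rcases (han 0 trivial).eventually_eq_zero_or_eventually_ne_zero with h | h
  · exfalso
    have h1 := han.eqOn_zero_of_preconnected_of_eventuallyEq_zero isPreconnected_univ trivial h
      (Set.mem_univ (1 : ℝ))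
    refine isCyclicPair_iff.1 hCw ?_
    simpa [hD] using h1
  · filter_upwards [h] with s hs
    exact isCyclicPair_iff.2 hs

end Cyclic

/-! ### Systems of dimension at most `M`. -/

section SmallDimension

variable {c : Coeffs} {M p d : ℕ}

theorem IsCyclicPair.krylovSpace_eq_top (hdM : d ≤ M) {g : E d → E d} {x₀ : E d}
    (h : IsCyclicPair (fderiv ℝ g x₀) (g x₀)) : krylovSpace M g x₀ = ⊤ := by
  rw [eq_top_iff, ← h]
  refine Submodule.span_mono ?_
  rintro _ ⟨i, rfl⟩
  exact ⟨i, i.2.trans_le hdM, rfl⟩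

theorem localOrder_of_isCyclicPair (hK : HasOrder (kMethod c M) p) (hdM : d ≤ M)
    {g : E d → E d} (hg : ContDiff ℝ ∞ g) {x₀ : E d}
    (h : IsCyclicPair (fderiv ℝ g x₀) (g x₀)) : LocalOrder c p g x₀ := by
  have hJ : krylovJacobian M g x₀ = fderiv ℝ g x₀ := by
    have hP : ∀ x, (krylovSpace M g x₀).starProjection x = x := fun x =>
      Submodule.starProjection_eq_self_iff.2 (by rw [h.krylovSpace_eq_top hdM]; trivial)
    ext1 x
    simp [krylovJacobian, hP]
  intro y hy0 hy
  have := hK d g hg x₀ y hy0 hy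
  simpa only [kMethod, hJ] using this

/-- In dimension at most `M`, the order of the `K`-method is inherited by the classical method. -/
theorem localOrder_of_le (hK : HasOrder (kMethod c M) p) (hdM : d ≤ M)
    {g : E d → E d} (hg : ContDiff ℝ ∞ g) (x₀ : E d) : LocalOrder c p g x₀ := by
  obtain ⟨C, w, hCw⟩ := exists_isCyclicPair d
  set J := fderiv ℝ g x₀ with hJ
  -- At `θ = (1, s)` the Jacobian and the value at `x₀` lie on the segment from `(J, g x₀)` to `(C,
  -- w)`. The first coordinate makes the family linear in `θ`.
  let f : ℝ × ℝ → E d → E d := fun θ x =>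
    θ.1 • g x + θ.2 • ((C - J) (x - x₀) + (w - g x₀))
  have hf : ContDiff ℝ ∞ (Function.uncurry f) := by
    have : ContDiff ℝ ∞ fun z : (ℝ × ℝ) × E d => g z.2 := hg.comp contDiff_snd
    simp only [Function.uncurry_def, f]
    fun_prop
  obtain ⟨m, hm⟩ := exists_orderConditions c p hf (fun h θ => by
    funext x; simp [f, mul_smul]) x₀
  have hf1 : ∀ s : ℝ, f (1, s) x₀ = g x₀ + s • (w - g x₀) := fun s => by simp [f]
  have hJ1 : ∀ s : ℝ, fderiv ℝ (f (1, s)) x₀ = J + s • (C - J) := fun s => by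
    have h1 : HasFDerivAt g J x₀ := (hg.differentiable (by simp) x₀).hasFDerivAt
    have h2 : HasFDerivAt (fun x => (C - J) (x - x₀) + (w - g x₀)) (C - J) x₀ := by
      have := (C - J).hasFDerivAt.comp x₀ ((hasFDerivAt_id x₀).sub_const x₀)
      exact this.add_const _
    have h3 : HasFDerivAt (f (1, s)) ((1 : ℝ) • J + s • (C - J)) x₀ :=
      (h1.const_smul (1 : ℝ)).add (h2.const_smul s)
    rw [h3.fderiv, one_smul]
  have hord : ∀ᶠ s in 𝓝[≠] (0 : ℝ), ∀ q ≤ p, m q (fun _ => (1, s)) = 0 := by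
    filter_upwards [eventually_isCyclicPair hCw J (g x₀)] with s hs
    refine (hm _).1 (localOrder_of_isCyclicPair hK hdM ?_ ?_)
    · exact hf.comp (contDiff_const.prodMk contDiff_id)
    · rwa [hf1, hJ1]
  have h0 : LocalOrder c p (f (1, 0)) x₀ := by
    refine (hm _).2 fun q hq => ?_
    have hc : Continuous fun s : ℝ => m q (fun _ => ((1 : ℝ), s)) :=
      (m q).cont.comp (by fun_prop)
    -- The conditions hold for all small `s ≠ 0`, hence at `s = 0` by continuity.
    refine tendsto_nhds_unique ((hc.tendsto 0).mono_left (nhdsWithin_le_nhds (s := {0}ᶜ))) ?_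
    refine tendsto_const_nhds.congr' ?_
    filter_upwards [hord] with s hs
    exact (hs q hq).symm
  have hfg : f (1, 0) = g := by funext x; simp [f]
  rwa [hfg] at h0

end SmallDimension

/-! ### Forms that vanish on short sums. -/

section Polarization

variable {Θ X κ : Type*} [AddCommGroup Θ] [Module ℝ Θ] [AddCommGroup X] [Module ℝ X]
  [DecidableEq κ]

/-- A form of degree `q` that vanishes on all sums of at most `q` of the vectors `v k` vanishes on
all their sums. -/
theorem map_sum_eq_zero_of_card_le {q : ℕ} (m : MultilinearMap ℝ (fun _ : Fin q => Θ) X)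
    (v : κ → Θ) (h : ∀ S : Finset κ, S.card ≤ q → m (fun _ => ∑ k ∈ S, v k) = 0)
    (S : Finset κ) : m (fun _ => ∑ k ∈ S, v k) = 0 := by
  -- `b R` collects the terms of the multilinear expansion whose indices form exactly the set `R`.
  let b : Finset κ → X := fun R =>
    ∑ r ∈ (Fintype.piFinset fun _ : Fin q => R) with Finset.univ.image r = R, m fun i => v (r i)
  have hsum : ∀ S : Finset κ, m (fun _ => ∑ k ∈ S, v k) = ∑ R ∈ S.powerset, b R := fun S => by
    rw [MultilinearMap.map_sum_finset,
      ← Finset.sum_fiberwise_of_maps_to (s := Fintype.piFinset fun _ : Fin q => S)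
        (t := S.powerset) (g := fun r => Finset.univ.image r)]
    · refine Finset.sum_congr rfl fun R hR => Finset.sum_congr ?_ fun _ _ => rfl
      ext r
      simp only [Finset.mem_filter, Fintype.mem_piFinset, and_congr_left_iff]
      rintro rfl
      simp only [Finset.mem_powerset, Finset.image_subset_iff] at hR
      simpa using hR
    · intro r hr
      simp only [Fintype.mem_piFinset] at hr
      simpa [Finset.image_subset_iff] using hr
  have hb : ∀ R : Finset κ, b R = 0 := fun R => by
    induction R using Finset.strongInduction with
    | H R ih =>
      -- For `R.card ≤ q`, proper subsets contribute `0` by induction, so the hypothesis on `R`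
      -- isolates `b R`. For larger `R` the sum is empty, as a `q`-tuple takes at most `q` values.
      rcases le_or_gt R.card q with hR | hR
      · have h1 := h R hR
        rwa [hsum, Finset.sum_eq_single_of_mem R (Finset.mem_powerset_self R) fun T hT hne =>
          ih T ((Finset.mem_powerset.1 hT).ssubset_of_ne hne)] at h1
      · refine Finset.sum_eq_zero fun r hr => ?_
        exfalso
        have h1 := (Finset.mem_filter.1 hr).2
        have h2 := Finset.card_image_le (s := (Finset.univ : Finset (Fin q))) (f := r)
        rw [h1] at h2
        simp at h2
        omega
  rw [hsum]
  exact Finset.sum_eq_zero fun R _ => hb R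

end Polarization

/-! ### Selecting components of the system. -/

section Main

variable {c : Coeffs} {M p N : ℕ}

/-- The composition of `f` with the orthogonal projection onto the coordinates in `S` is a system
of dimension at most `S.card`. -/
theorem localOrder_coordinates (hK : HasOrder (kMethod c M) p) {f : E N → E N}
    (hf : ContDiff ℝ ∞ f) (y₀ : E N) {S : Finset (Fin N)} (hS : S.card ≤ M) :
    LocalOrder c p (fun y => ∑ k ∈ S, f y k • EuclideanSpace.single k (1 : ℝ)) y₀ := by
  let σ : Fin S.card ≃ S := S.equivFin.symm
  let ι : E S.card →L[ℝ] E N :=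
    ∑ j, (EuclideanSpace.proj j : E S.card →L[ℝ] ℝ).smulRight
      (EuclideanSpace.single (σ j : Fin N) (1 : ℝ))
  -- The projected field takes values in the range of `ι`, so it preserves `y₀ + range ι`; `g` is
  -- its expression in the coordinates of that plane.
  let g : E S.card → E S.card := fun x => WithLp.toLp 2 fun j => f (y₀ + ι x) (σ j)
  have hg : ContDiff ℝ ∞ g := by
    rw [contDiff_euclidean]
    intro j
    exact (contDiff_euclidean.1 hf (σ j)).comp (contDiff_const.add ι.contDiff)
  refine LocalOrder.of_intertwine (ι := ι) (g := g) ?_ hg (fun x => ?_)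
    (localOrder_of_le hK hS hg 0)
  · exact ContDiff.sum fun k _ => (contDiff_euclidean.1 hf k).smul contDiff_const
  · rw [← Finset.sum_coe_sort S, ← σ.sum_comp]
    simp [ι, g]

end Main

end EPIRK

end

theorem mainTheorem4 (c : EPIRK.Coeffs) (hs : 1 ≤ c.s) (M p : ℕ) (hpM : p ≤ M)
    (hK : EPIRK.HasOrder (EPIRK.kMethod c M) p) :
    EPIRK.HasOrder (EPIRK.classicalMethod c) p := by
  intro N f hf y₀
  -- The weights `θ` switch components of `f` on and off; all weights equal to `1` give back `f`.
  let F : (Fin N → ℝ) → EPIRK.E N → EPIRK.E N := fun θ y =>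
    ∑ k, θ k • f y k • EuclideanSpace.single k (1 : ℝ)
  have hF : ContDiff ℝ ∞ (Function.uncurry F) := by
    refine ContDiff.sum fun k _ => ?_
    exact ((contDiff_apply ℝ ℝ k).comp contDiff_fst).smul
      (((contDiff_euclidean.1 hf k).comp contDiff_snd).smul contDiff_const)
  obtain ⟨m, hm⟩ := EPIRK.exists_orderConditions c p hF (fun h θ => by
    funext y; simp [F, mul_smul, Finset.smul_sum]) y₀
  let v : Fin N → Fin N → ℝ := fun k => Pi.single k 1
  have hFv : ∀ S : Finset (Fin N), F (∑ k ∈ S, v k)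
      = fun y => ∑ k ∈ S, f y k • EuclideanSpace.single k (1 : ℝ) := fun S => by
    funext y
    simp [F, v, Finset.sum_apply, Pi.single_apply, ite_smul]
  have hf1 : F (∑ k, v k) = f := by
    rw [hFv]
    funext y
    ext i
    simp [Finset.sum_apply, Pi.single_apply]
  -- Only sets with `S.card ≤ q ≤ p ≤ M` have to be tested; this is where `p ≤ M` enters.
  have key : EPIRK.LocalOrder c p (F (∑ k, v k)) y₀ := (hm _).2 fun q hq =>
    EPIRK.map_sum_eq_zero_of_card_le (m q).toMultilinearMap v (fun S hS => by
      refine (hm _).1 ?_ q hq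
      rw [hFv]
      exact EPIRK.localOrder_coordinates hK hf y₀ (by omega)) _
  rw [hf1] at key
  exact key
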